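/- Let $t\ge s\ge 0$, $k\ge 1$ and $\omega\ge 0$ be integers such that either $(t+k)/2>\omega\ge t-k$, or $\omega\le k$. There is a constant $C$, depending only on $t,s,k,\omega$, such that the following holds for every finite field $\mathbf F$ with $q=|\mathbf F|$ elements for which there exist sets $A,B\subseteq\mathbf F$ with $|A|=t$, $|B|=s$, $|A\cap B|=\omega$. Let $(A,B)$ be uniformly distributed over all such pairs of feature sets, and let $V=f+\prod_{a\in A}(X-a)$ and $W=g+\prod_{b\in B}(X-b)$ be vault records of $A$ and $B$ in the improved fuzzy vault scheme. Here each of the secret polynomials $f,g\in\mathbf F[X]$ of degree $<k$ is chosen in one of two ways: either uniformly at random among all polynomials of degree $<k$, independently of everything else (probabilistic variant), or as minus the sum of the terms of degree $<k$ of the characteristic polynomial $\prod_{a\in A}(X-a)$, respectively $\prod_{b\in B}(X-b)$ (deterministic variant). Then every algorithm, possibly randomized and computationally unbounded, that takes $(V,W)$ as input outputs an element of $(A\cup B)\setminus(A\cap B)$ with probability at most $C/q$. That is, for fixed $t,s,k,\omega$ the success probability is in $\mathcal O(q^{-1})$. -/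

import Mathlib

open scoped Polynomial

namespace FuzzyVault

/-- The two variants of the improved fuzzy vault scheme. -/
inductive Variant where
  | probabilistic
  | deterministic

noncomputable section

variable {F : Type*} [Field F]

/-- The characteristic polynomial `∏ x ∈ A, (X - x)` of a feature set. -/
def charPoly (A : Finset F) : F[X] := ∏ x ∈ A, (Polynomial.X - Polynomial.C x)

/-- The polynomial of degree `< k` with coefficient vector `c`. -/
def polyOfCoeffs {k : ℕ} (c : Fin k → F) : F[X] :=
  ∑ i : Fin k, Polynomial.C (c i) * Polynomial.X ^ (i : ℕ)

/-- The distribution of the secret polynomial (of degree `< k`) of a vault record of `A`: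
uniform among all polynomials of degree `< k` in the probabilistic variant (the coefficients are
independent and uniform), and minus the part of degree `< k` of the characteristic polynomial of
`A` in the deterministic variant. -/
def secretDist [Fintype F] (v : Variant) (k : ℕ) (A : Finset F) : PMF F[X] :=
  match v with
  | .probabilistic => (PMF.uniformOfFintype (Fin k → F)).map polyOfCoeffs
  | .deterministic => PMF.pure (-polyOfCoeffs fun i : Fin k => (charPoly A).coeff i)

/-- The distribution of the vault record `f + charPoly A` of the feature set `A`. -/
def vaultDist [Fintype F] (v : Variant) (k : ℕ) (A : Finset F) : PMF F[X] :=
  (secretDist v k A).map fun f => f + charPoly A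

/-- All pairs of feature sets of sizes `t` and `s` that overlap in exactly `ω` elements. -/
def featurePairs (F : Type*) [Fintype F] [DecidableEq F] (t s ω : ℕ) :
    Finset (Finset F × Finset F) :=
  Finset.univ.filter fun p => p.1.card = t ∧ p.2.card = s ∧ (p.1 ∩ p.2).card = ω

/-- A (randomized, computationally unbounded) attack: from two vault records it produces a random
field element, or `none` if it fails. -/
abbrev Attack (F : Type*) [Field F] := F[X] → F[X] → PMF (Option F)

/-- The attack experiment. A pair `(A, B)` of feature sets is drawn uniformly from
`featurePairs F t s ω`, then vault records `V` of `A` and `W` of `B` are generated with independent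
randomness, and the attack `𝒜` is run on `(V, W)`. The outcome is `(A, B)` together with the output
of `𝒜`. -/
def experiment [Fintype F] [DecidableEq F] (v w : Variant) (k : ℕ) {t s ω : ℕ}
    (hne : (featurePairs F t s ω).Nonempty) (𝒜 : Attack F) :
    PMF ((Finset F × Finset F) × Option F) :=
  (PMF.uniformOfFinset (featurePairs F t s ω) hne).bind fun p =>
    (vaultDist v k p.1).bind fun V =>
      (vaultDist w k p.2).bind fun W =>
        (𝒜 V W).map fun o => (p, o)

/-- The probability that the attack outputs an element of `(A ∪ B) \ (A ∩ B)`. -/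
def successProb [Fintype F] [DecidableEq F] (v w : Variant) (k : ℕ) {t s ω : ℕ}
    (hne : (featurePairs F t s ω).Nonempty) (𝒜 : Attack F) : ℝ :=
  ((experiment v w k hne 𝒜).toOuterMeasure
    {z | ∃ x ∈ (z.1.1 ∪ z.1.2) \ (z.1.1 ∩ z.1.2), z.2 = some x}).toReal

end

end FuzzyVault

/-!
A vault record of `A` is determined, up to randomness independent of `A`, by the terms of degree
`≥ k` of the characteristic polynomial `χ_A` (`vaultDist_eq_recordDist`). An attack therefore
guesses an element of the symmetric difference from the pair of upper parts `(u, w)` of `A` and `B`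
only, and its success probability is at most the number of possible `(u, w)`, which is at most
`q ^ ((t - k) + (s - k))` (truncated subtraction), times the largest number of feature pairs with
given `(u, w)` for which a given `x` is a correct answer, divided by the number of all feature
pairs (`successProb_le`). The last number is at least a constant times `q ^ (t + s - ω)`
(`pow_le_card_featurePairs`), so it remains to count the pairs for given `u`, `w`, `x`
(`card_pairs_mul_pow_le`). Every count rests on one fact (`card_le_of_dvd_sub`): at most
`q ^ (d - j)` polynomials are congruent modulo a monic polynomial of degree `j` with differences of
degree `< d`.

If `ω ≤ k`, the set containing `x` is chosen first, then the intersection inside it, then the other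
set, which has prescribed upper part and contains the intersection (`card_pairs_le_of_mem_fst`).

If `k < ω`, the pairs are compared with a fixed pair `(A₀, B₀)` that has the same upper parts. Put
`P = χ_{B \ A}`, `Q = χ_{A \ B}`, and likewise `P₀`, `Q₀`. Since `P χ_A = Q χ_B`, the product of
`P Q₀ - Q P₀` with `χ_{A₀ ∩ B₀}` equals `P (χ_{A₀} - χ_A) - Q (χ_{B₀} - χ_B)`, whose degree is less
than `t - ω + k`. So `P Q₀ - Q P₀` has degree less than `t + k - 2 ω`, and it vanishes at `x` when
`x` lies on the same side of both pairs. As `P₀` and `Q₀` are coprime, it determines `P` and `Q`;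
and once `A \ B` is known, at most `q ^ (k - (t - ω))` sets `A ⊇ A \ B` have upper part `u`
(`card_pairs_le_of_eval_crossDiff`).
-/

namespace FuzzyVault
open Polynomial

/-! ### Characteristic polynomials and their upper parts -/

section Polynomials
variable {F : Type*} [Field F]

/-- If `d < J.natDegree`, the subtraction in the exponent truncates, in accordance with the fact
that `S` then has at most one element. -/
lemma card_le_of_dvd_sub [Fintype F] (S : Finset F[X]) (J : F[X]) (hJ : J.Monic) (d : ℕ)
    (hS : ∀ p ∈ S, ∀ p' ∈ S, J ∣ p - p' ∧ (p - p').degree < d) :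
    S.card ≤ Fintype.card F ^ (d - J.natDegree) := by
  classical
  obtain rfl | ⟨p₀, hp₀⟩ := S.eq_empty_or_nonempty
  · simp
  have h : ∀ p ∈ S, ((p - p₀) /ₘ J).degree < (d - J.natDegree : ℕ) ∧
      p = J * ((p - p₀) /ₘ J) + p₀ := by
    intro p hp
    obtain ⟨⟨c, hc⟩, hd⟩ := hS p hp p₀ hp₀
    have hq : (p - p₀) /ₘ J = c := by rw [hc, mul_divByMonic_cancel_left _ hJ]
    rw [hq, ← hc]
    refine ⟨?_, by ring⟩
    by_cases h0 : c = 0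
    · simp [h0]
    rw [hc, degree_mul, degree_eq_natDegree hJ.ne_zero, degree_eq_natDegree h0] at hd
    rw [degree_eq_natDegree h0]
    norm_cast at hd ⊢
    omega
  let φ : F[X] → Fin (d - J.natDegree) → F := fun p i => ((p - p₀) /ₘ J).coeff i
  have hinj : Set.InjOn φ S := by
    intro p hp p' hp' hpp
    rw [(h p hp).2, (h p' hp').2]
    congr 2
    ext i
    by_cases hi : i < d - J.natDegree
    · exact congrFun hpp ⟨i, hi⟩
    · rw [coeff_eq_zero_of_degree_lt, coeff_eq_zero_of_degree_lt]
      · exact (h p' hp').1.trans_le (by exact_mod_cast not_lt.1 hi)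
      · exact (h p hp).1.trans_le (by exact_mod_cast not_lt.1 hi)
  calc S.card ≤ (Finset.univ : Finset (Fin (d - J.natDegree) → F)).card :=
        Finset.card_le_card_of_injOn φ (fun _ _ => Finset.mem_coe.2 (Finset.mem_univ _)) hinj
    _ = _ := by simp

lemma monic_charPoly (A : Finset F) : (charPoly A).Monic := monic_prod_X_sub_C _ _

lemma natDegree_charPoly (A : Finset F) : (charPoly A).natDegree = A.card := by
  simp [charPoly]

lemma charPoly_injective : Function.Injective (charPoly : Finset F → F[X]) := by
  intro A B h
  have := congrArg Polynomial.roots h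
  simpa [charPoly, roots_prod_X_sub_C] using this

lemma eval_charPoly_eq_zero {A : Finset F} {x : F} (hx : x ∈ A) : (charPoly A).eval x = 0 := by
  rw [charPoly, eval_prod]
  exact Finset.prod_eq_zero hx (by simp)

lemma charPoly_dvd {A B : Finset F} (h : A ⊆ B) : charPoly A ∣ charPoly B :=
  Finset.prod_dvd_prod_of_subset _ _ _ h

lemma charPoly_union [DecidableEq F] {A B : Finset F} (h : Disjoint A B) :
    charPoly (A ∪ B) = charPoly A * charPoly B := Finset.prod_union h

lemma isCoprime_charPoly {A B : Finset F} (h : Disjoint A B) :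
    IsCoprime (charPoly A) (charPoly B) := by
  refine IsCoprime.prod_left fun a ha => IsCoprime.prod_right fun b hb => ?_
  exact isCoprime_X_sub_C_of_isUnit_sub
    (sub_ne_zero.2 fun hab : a = b => Finset.disjoint_left.1 h ha (hab ▸ hb)).isUnit

lemma degree_charPoly_sub_lt {A B : Finset F} (h : A.card = B.card) :
    (charPoly A - charPoly B).degree < A.card := by
  by_cases h0 : A.card = 0
  · have hA := Finset.card_eq_zero.1 h0
    have hB := Finset.card_eq_zero.1 (h ▸ h0)
    subst hA hB
    simp [charPoly]
  have := degree_sub_lt_left (p := charPoly A) (q := charPoly B) (by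
    rw [degree_eq_natDegree (monic_charPoly A).ne_zero,
      degree_eq_natDegree (monic_charPoly B).ne_zero, natDegree_charPoly, natDegree_charPoly, h])
    (monic_charPoly A).ne_zero (by
      rw [(monic_charPoly A).leadingCoeff, (monic_charPoly B).leadingCoeff])
  rwa [degree_eq_natDegree (monic_charPoly A).ne_zero, natDegree_charPoly] at this

lemma coeff_polyOfCoeffs {k : ℕ} (c : Fin k → F) (n : ℕ) :
    (polyOfCoeffs c).coeff n = if h : n < k then c ⟨n, h⟩ else 0 := by
  rw [polyOfCoeffs, finsetSum_coeff]
  simp only [coeff_C_mul, coeff_X_pow]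
  split_ifs with h
  · rw [Finset.sum_eq_single ⟨n, h⟩]
    · simp
    · intro b _ hb
      have : n ≠ b := fun e => hb (Fin.ext e.symm)
      simp [this]
    · simp
  · refine Finset.sum_eq_zero fun i _ => ?_
    have : n ≠ i := fun e => h (e ▸ i.2)
    simp [this]

lemma polyOfCoeffs_add {k : ℕ} (c d : Fin k → F) :
    polyOfCoeffs (c + d) = polyOfCoeffs c + polyOfCoeffs d := by
  simp [polyOfCoeffs, add_mul, Finset.sum_add_distrib]

/-- The terms of degree `≥ k` of the characteristic polynomial of `A`: all that a vault record
reveals about `A`. -/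
noncomputable def upperPart (k : ℕ) (A : Finset F) : F[X] :=
  charPoly A - polyOfCoeffs fun i : Fin k => (charPoly A).coeff i

lemma coeff_upperPart (k : ℕ) (A : Finset F) (n : ℕ) :
    (upperPart k A).coeff n = if n < k then 0 else (charPoly A).coeff n := by
  rw [upperPart, coeff_sub, coeff_polyOfCoeffs]
  split_ifs <;> simp

lemma degree_charPoly_sub_lt_of_upperPart_eq {k : ℕ} {A B : Finset F}
    (h : upperPart k A = upperPart k B) : (charPoly A - charPoly B).degree < k := by
  rw [degree_lt_iff_coeff_zero]
  intro n hn
  have := congrArg (fun p => p.coeff n) h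
  simp only [coeff_upperPart, if_neg (not_lt.2 hn)] at this
  rw [coeff_sub, this, sub_self]

lemma card_image_upperPart_le [Fintype F] [DecidableEq F[X]] (k t : ℕ) (S : Finset (Finset F))
    (hS : ∀ A ∈ S, A.card = t) :
    (S.image (upperPart k)).card ≤ Fintype.card F ^ (t - k) := by
  have := card_le_of_dvd_sub (S.image (upperPart k)) (X ^ k) (monic_X_pow k) t ?_
  · simpa using this
  simp only [Finset.mem_image]
  rintro _ ⟨A, hA, rfl⟩ _ ⟨B, hB, rfl⟩
  refine ⟨X_pow_dvd_iff.2 fun d hd => by simp [coeff_upperPart, hd], ?_⟩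
  rw [degree_lt_iff_coeff_zero]
  intro n hn
  rw [coeff_sub, coeff_upperPart, coeff_upperPart]
  split_ifs
  · simp
  rw [← coeff_sub]
  refine coeff_eq_zero_of_degree_lt
    ((degree_charPoly_sub_lt ((hS A hA).trans (hS B hB).symm)).trans_le ?_)
  rw [hS A hA]
  exact_mod_cast hn

/-- Sets of `t` elements with a prescribed upper part and prescribed elements: each prescribed
element costs a factor `q`. The minimum covers `t < k`, where the upper part is no constraint. -/
lemma card_upperPart_eq_superset_le [Fintype F] (k t : ℕ) (u : F[X]) (J : Finset F)
    (S : Finset (Finset F)) (hS : ∀ A ∈ S, A.card = t ∧ upperPart k A = u ∧ J ⊆ A) :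
    S.card ≤ Fintype.card F ^ (min k t - J.card) := by
  classical
  have := card_le_of_dvd_sub (S.image charPoly) (charPoly J) (monic_charPoly J) (min k t) ?_
  · rwa [Finset.card_image_of_injective _ charPoly_injective, natDegree_charPoly] at this
  simp only [Finset.mem_image]
  rintro _ ⟨A, hA, rfl⟩ _ ⟨B, hB, rfl⟩
  obtain ⟨hA1, hA2, hA3⟩ := hS A hA
  obtain ⟨hB1, hB2, hB3⟩ := hS B hB
  refine ⟨dvd_sub (charPoly_dvd hA3) (charPoly_dvd hB3), ?_⟩
  rcases min_choice k t with h | h <;> rw [h]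
  · exact degree_charPoly_sub_lt_of_upperPart_eq (hA2.trans hB2.symm)
  · rw [← hA1]; exact degree_charPoly_sub_lt (hA1.trans hB1.symm)

end Polynomials

/-! ### Counting feature pairs -/

section Counting
variable {F : Type*} [Field F]

/-- The count for small `ω`, by choosing `A`, then `A ∩ B ⊆ A`, then `B ⊇ A ∩ B`. -/
lemma card_pairs_le_of_mem_fst [Fintype F] [DecidableEq F] (k a b ω : ℕ) (u w : F[X]) (x : F)
    (T : Finset (Finset F × Finset F))
    (hT : ∀ p ∈ T, (p.1.card = a ∧ p.2.card = b ∧ (p.1 ∩ p.2).card = ω) ∧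
      upperPart k p.1 = u ∧ upperPart k p.2 = w ∧ x ∈ p.1) :
    T.card ≤ Fintype.card F ^ (min k b - ω) * 2 ^ a * Fintype.card F ^ (min k a - 1) := by
  refine (Finset.card_le_mul_card_image (f := Prod.fst) T
    (Fintype.card F ^ (min k b - ω) * 2 ^ a) ?_).trans (Nat.mul_le_mul_left _ ?_)
  · intro A hA
    obtain ⟨p₀, hp₀, rfl⟩ := Finset.mem_image.1 hA
    have hcard : p₀.1.powerset.card = 2 ^ a := by
      rw [Finset.card_powerset, (hT p₀ hp₀).1.1]
    rw [← hcard]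
    refine Finset.card_le_mul_card_image_of_maps_to (f := fun p => p.1 ∩ p.2) ?_ _ ?_
    · intro p hp
      rw [← (Finset.mem_filter.1 hp).2]
      exact Finset.mem_powerset.2 Finset.inter_subset_left
    · intro C _
      have hfib : ∀ p ∈ {p ∈ {p ∈ T | p.1 = p₀.1} | p.1 ∩ p.2 = C},
          p ∈ T ∧ p.1 = p₀.1 ∧ p.1 ∩ p.2 = C := by
        intro p hp
        simpa only [Finset.mem_filter, and_assoc] using hp
      generalize {p ∈ {p ∈ T | p.1 = p₀.1} | p.1 ∩ p.2 = C} = S at hfib ⊢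
      obtain rfl | ⟨p₁, hp₁⟩ := S.eq_empty_or_nonempty
      · simp
      have hC : C.card = ω := by
        obtain ⟨h1, -, rfl⟩ := hfib p₁ hp₁
        exact (hT _ h1).1.2.2
      rw [← hC, ← Finset.card_image_of_injOn (f := Prod.snd) (s := S)]
      · refine card_upperPart_eq_superset_le k b w C _ fun B hB => ?_
        obtain ⟨p, hp, rfl⟩ := Finset.mem_image.1 hB
        obtain ⟨h1, -, rfl⟩ := hfib p hp
        exact ⟨(hT p h1).1.2.1, (hT p h1).2.2.1, Finset.inter_subset_right⟩
      · intro p hp p' hp' h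
        exact Prod.ext ((hfib p hp).2.1.trans (hfib p' hp').2.1.symm) h
  · have := card_upperPart_eq_superset_le k a u {x} (T.image Prod.fst) ?_
    · simpa using this
    · intro A hA
      obtain ⟨p, hp, rfl⟩ := Finset.mem_image.1 hA
      exact ⟨(hT p hp).1.1, (hT p hp).2.1, Finset.singleton_subset_iff.2 (hT p hp).2.2.2⟩

lemma degree_mul_lt_add {p q : F[X]} {a b : ℕ} (hp : p.natDegree ≤ a) (hq : q.degree < b) :
    (p * q).degree < (a + b : ℕ) := by
  by_cases h : p * q = 0
  · rw [h, degree_zero]; exact WithBot.bot_lt_coe _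
  have hp0 := left_ne_zero_of_mul h
  have hq0 := right_ne_zero_of_mul h
  rw [degree_mul, degree_eq_natDegree hp0, degree_eq_natDegree hq0]
  rw [degree_eq_natDegree hq0] at hq
  norm_cast at hq ⊢
  omega

/-- For pairs `p = (A, B)` and `p' = (A', B')` this is
`χ_{B \ A} * χ_{A' \ B'} - χ_{A \ B} * χ_{B' \ A'}`, where `χ` is the characteristic polynomial.
It is the numerator of the difference of the rational functions `χ_{A'} / χ_{B'}` and
`χ_A / χ_B`, whose reduced forms are `χ_{A' \ B'} / χ_{B' \ A'}` and `χ_{A \ B} / χ_{B \ A}`. -/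
noncomputable def crossDiff [DecidableEq F] (p p' : Finset F × Finset F) : F[X] :=
  charPoly (p.2 \ p.1) * charPoly (p'.1 \ p'.2) - charPoly (p.1 \ p.2) * charPoly (p'.2 \ p'.1)

lemma charPoly_sdiff_mul_charPoly [DecidableEq F] (A B : Finset F) :
    charPoly (B \ A) * charPoly A = charPoly (A \ B) * charPoly B := by
  rw [← charPoly_union Finset.sdiff_disjoint, ← charPoly_union Finset.sdiff_disjoint,
    Finset.sdiff_union_self_eq_union, Finset.sdiff_union_self_eq_union, Finset.union_comm]

lemma charPoly_sdiff_mul_charPoly_inter [DecidableEq F] (A B : Finset F) :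
    charPoly (A \ B) * charPoly (A ∩ B) = charPoly A := by
  rw [← charPoly_union (Finset.disjoint_sdiff_inter A B), Finset.sdiff_union_inter]

lemma charPoly_inter_mul_crossDiff [DecidableEq F] (p p' : Finset F × Finset F) :
    charPoly (p'.1 ∩ p'.2) * crossDiff p p' =
      charPoly (p.2 \ p.1) * (charPoly p'.1 - charPoly p.1) -
        charPoly (p.1 \ p.2) * (charPoly p'.2 - charPoly p.2) := by
  have h1 := charPoly_sdiff_mul_charPoly p.1 p.2
  have h2 := charPoly_sdiff_mul_charPoly_inter p'.1 p'.2
  have h3 := charPoly_sdiff_mul_charPoly_inter p'.2 p'.1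
  rw [Finset.inter_comm] at h3
  rw [crossDiff, ← h2, ← h3]
  linear_combination h1

/-- For pairs with equal upper parts, the large common factor `χ_{A' ∩ B'}` leaves little room
for the cross difference. -/
lemma degree_crossDiff_lt [DecidableEq F] {k t s ω : ℕ} (hst : s ≤ t)
    {p p' : Finset F × Finset F}
    (hp : p.1.card = t ∧ p.2.card = s ∧ (p.1 ∩ p.2).card = ω) (hp' : (p'.1 ∩ p'.2).card = ω)
    (h1 : upperPart k p.1 = upperPart k p'.1) (h2 : upperPart k p.2 = upperPart k p'.2) :
    (crossDiff p p').degree < (t + k - 2 * ω : ℕ) := by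
  obtain ⟨ht, hs, hω⟩ := hp
  have c1 := Finset.card_sdiff_add_card_inter p.1 p.2
  have c2 := Finset.card_sdiff_add_card_inter p.2 p.1
  rw [Finset.inter_comm] at c2
  have hdeg : (charPoly (p'.1 ∩ p'.2) * crossDiff p p').degree < (t - ω + k : ℕ) := by
    rw [charPoly_inter_mul_crossDiff]
    refine (degree_sub_le _ _).trans_lt (max_lt ?_ ?_)
    · exact degree_mul_lt_add (by rw [natDegree_charPoly]; omega)
        (degree_charPoly_sub_lt_of_upperPart_eq h1.symm)
    · exact degree_mul_lt_add (by rw [natDegree_charPoly]; omega)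
        (degree_charPoly_sub_lt_of_upperPart_eq h2.symm)
  by_cases h0 : crossDiff p p' = 0
  · rw [h0, degree_zero]; exact WithBot.bot_lt_coe _
  rw [degree_mul, degree_eq_natDegree (monic_charPoly _).ne_zero, degree_eq_natDegree h0,
    natDegree_charPoly, hp'] at hdeg
  rw [degree_eq_natDegree h0]
  norm_cast at hdeg ⊢
  omega

/-- A pair of feature sets can be recovered, up to its intersection, from its cross difference
with a fixed pair: this is the uniqueness in Bézout's identity for the coprime polynomials
`χ_{A' \ B'}` and `χ_{B' \ A'}`. -/
lemma sdiff_eq_of_crossDiff_eq [DecidableEq F] {p₁ p₂ p' : Finset F × Finset F}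
    (h : crossDiff p₁ p' = crossDiff p₂ p')
    (h₁ : (p₁.2 \ p₁.1).card = (p'.2 \ p'.1).card)
    (h₂ : (p₂.2 \ p₂.1).card = (p'.2 \ p'.1).card) :
    p₁.1 \ p₁.2 = p₂.1 \ p₂.2 ∧ p₁.2 \ p₁.1 = p₂.2 \ p₂.1 := by
  simp only [crossDiff] at h
  have hcop : IsCoprime (charPoly (p'.2 \ p'.1)) (charPoly (p'.1 \ p'.2)) :=
    isCoprime_charPoly disjoint_sdiff_sdiff
  have hP : charPoly (p₁.2 \ p₁.1) = charPoly (p₂.2 \ p₂.1) := by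
    have hdvd : charPoly (p'.2 \ p'.1) ∣ charPoly (p₁.2 \ p₁.1) - charPoly (p₂.2 \ p₂.1) := by
      refine hcop.dvd_of_dvd_mul_right ⟨charPoly (p₁.1 \ p₁.2) - charPoly (p₂.1 \ p₂.2), ?_⟩
      linear_combination h
    refine sub_eq_zero.1 (eq_zero_of_dvd_of_degree_lt hdvd ?_)
    rw [degree_eq_natDegree (monic_charPoly _).ne_zero, natDegree_charPoly, ← h₁]
    exact degree_charPoly_sub_lt (h₁.trans h₂.symm)
  have hQ : charPoly (p₁.1 \ p₁.2) = charPoly (p₂.1 \ p₂.2) := by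
    rw [hP] at h
    exact mul_right_cancel₀ (monic_charPoly (p'.2 \ p'.1)).ne_zero (by linear_combination -h)
  exact ⟨charPoly_injective hQ, charPoly_injective hP⟩

/-- The count for large `ω`: there are few cross differences with a fixed pair, and each of them
determines `A \ B` and `B \ A`. -/
lemma card_pairs_le_of_eval_crossDiff [Fintype F] [DecidableEq F] (k t s ω : ℕ) (hst : s ≤ t)
    (u w : F[X]) (x : F) (T : Finset (Finset F × Finset F))
    (hT : ∀ p ∈ T, (p.1.card = t ∧ p.2.card = s ∧ (p.1 ∩ p.2).card = ω) ∧
      upperPart k p.1 = u ∧ upperPart k p.2 = w)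
    (hx : ∀ p ∈ T, ∀ p' ∈ T, (crossDiff p p').eval x = 0) :
    T.card ≤ Fintype.card F ^ (min k t - (t - ω)) * Fintype.card F ^ (t + k - 2 * ω - 1) := by
  classical
  have hsdiff : ∀ p ∈ T, (p.1 \ p.2).card = t - ω ∧ (p.2 \ p.1).card = s - ω := by
    intro p hp
    obtain ⟨⟨ht, hs, hω⟩, -⟩ := hT p hp
    have c1 := Finset.card_sdiff_add_card_inter p.1 p.2
    have c2 := Finset.card_sdiff_add_card_inter p.2 p.1
    rw [Finset.inter_comm] at c2
    omega
  obtain rfl | ⟨p₀, hp₀⟩ := T.eq_empty_or_nonempty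
  · simp
  refine (Finset.card_le_mul_card_image (f := fun p => crossDiff p p₀) T
    (Fintype.card F ^ (min k t - (t - ω))) ?_).trans (Nat.mul_le_mul_left _ ?_)
  · intro R hR
    obtain ⟨p₁, hp₁, rfl⟩ := Finset.mem_image.1 hR
    have hfib : ∀ p ∈ {p ∈ T | crossDiff p p₀ = crossDiff p₁ p₀},
        p ∈ T ∧ p.1 \ p.2 = p₁.1 \ p₁.2 ∧ p.2 \ p.1 = p₁.2 \ p₁.1 := by
      intro p hp
      obtain ⟨hpT, hpR⟩ := Finset.mem_filter.1 hp
      exact ⟨hpT, sdiff_eq_of_crossDiff_eq hpR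
        ((hsdiff p hpT).2.trans (hsdiff p₀ hp₀).2.symm)
        ((hsdiff p₁ hp₁).2.trans (hsdiff p₀ hp₀).2.symm)⟩
    rw [← (hsdiff p₁ hp₁).1, ← Finset.card_image_of_injOn (f := Prod.fst)]
    · refine card_upperPart_eq_superset_le k t u (p₁.1 \ p₁.2) _ fun A hA => ?_
      obtain ⟨p, hp, rfl⟩ := Finset.mem_image.1 hA
      obtain ⟨hpT, h1, -⟩ := hfib p hp
      exact ⟨(hT p hpT).1.1, (hT p hpT).2.1, h1 ▸ Finset.sdiff_subset⟩
    · -- `B` is determined by `A`, `A \ B` and `B \ A`.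
      have hrec : ∀ p : Finset F × Finset F, p.2 = p.1 \ (p.1 \ p.2) ∪ (p.2 \ p.1) := by
        intro p; ext y; simp; tauto
      intro p hp p' hp' h
      obtain ⟨-, h1, h2⟩ := hfib p hp
      obtain ⟨-, h1', h2'⟩ := hfib p' hp'
      refine Prod.ext h ?_
      rw [hrec p, hrec p', h1, h2, h1', h2', h]
  · have := card_le_of_dvd_sub (T.image fun p => crossDiff p p₀) (X - C x) (monic_X_sub_C x)
      (t + k - 2 * ω) ?_
    · simpa using this
    intro R hR R' hR'
    obtain ⟨p, hp, rfl⟩ := Finset.mem_image.1 hR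
    obtain ⟨p', hp', rfl⟩ := Finset.mem_image.1 hR'
    have hd : ∀ p ∈ T, (crossDiff p p₀).degree < (t + k - 2 * ω : ℕ) := fun p hp =>
      degree_crossDiff_lt hst (hT p hp).1 (hT p₀ hp₀).1.2.2
        ((hT p hp).2.1.trans (hT p₀ hp₀).2.1.symm) ((hT p hp).2.2.trans (hT p₀ hp₀).2.2.symm)
    exact ⟨dvd_sub (dvd_iff_isRoot.2 (hx p hp p₀ hp₀)) (dvd_iff_isRoot.2 (hx p' hp' p₀ hp₀)),
      (degree_sub_le _ _).trans_lt (max_lt (hd p hp) (hd p' hp'))⟩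

lemma eval_crossDiff_of_mem_fst [DecidableEq F] {p p' : Finset F × Finset F} {x : F}
    (h : x ∈ p.1 \ p.2) (h' : x ∈ p'.1 \ p'.2) : (crossDiff p p').eval x = 0 := by
  simp [crossDiff, eval_charPoly_eq_zero h, eval_charPoly_eq_zero h']

lemma eval_crossDiff_of_mem_snd [DecidableEq F] {p p' : Finset F × Finset F} {x : F}
    (h : x ∈ p.2 \ p.1) (h' : x ∈ p'.2 \ p'.1) : (crossDiff p p').eval x = 0 := by
  simp [crossDiff, eval_charPoly_eq_zero h, eval_charPoly_eq_zero h']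

/-- Among the feature pairs with given upper parts, those for which a fixed element `x` is a
correct answer of the attack are few: up to a constant, at most `1 / q` times the average number of
feature pairs per pair of upper parts. -/
lemma card_pairs_mul_pow_le [Fintype F] [DecidableEq F] (k t s ω : ℕ) (hk : 1 ≤ k) (hst : s ≤ t)
    (hω : (2 * ω < t + k ∧ t ≤ ω + k) ∨ ω ≤ k) (u w : F[X]) (x : F)
    (T : Finset (Finset F × Finset F))
    (hT : ∀ p ∈ T, (p.1.card = t ∧ p.2.card = s ∧ (p.1 ∩ p.2).card = ω) ∧
      upperPart k p.1 = u ∧ upperPart k p.2 = w ∧ x ∈ (p.1 ∪ p.2) \ (p.1 ∩ p.2)) :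
    T.card * Fintype.card F ^ ((t - k) + (s - k) + 1) ≤
      2 * 2 ^ t * Fintype.card F ^ (t + s - ω) := by
  set q := Fintype.card F with hq
  -- Cross differences vanish at `x` only for pairs with `x` on the same side.
  have key : ∀ S ⊆ T, ((∀ p ∈ S, x ∈ p.1 \ p.2) ∨ (∀ p ∈ S, x ∈ p.2 \ p.1)) →
      S.card * q ^ ((t - k) + (s - k) + 1) ≤ 2 ^ t * q ^ (t + s - ω) := by
    intro S hS hside
    obtain rfl | ⟨p₀, hp₀⟩ := S.eq_empty_or_nonempty
    · simp
    obtain ⟨⟨ht, hs, hω'⟩, -⟩ := hT p₀ (hS hp₀)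
    have hωt : ω ≤ t := hω' ▸ ht ▸ Finset.card_le_card Finset.inter_subset_left
    have hωs : ω ≤ s := hω' ▸ hs ▸ Finset.card_le_card Finset.inter_subset_right
    by_cases hωk : ω ≤ k
    · -- Start from the set that contains `x`.
      rcases hside with hx | hx
      · have ht1 : 1 ≤ t := ht ▸ Finset.card_pos.2 ⟨x, (Finset.mem_sdiff.1 (hx p₀ hp₀)).1⟩
        have := card_pairs_le_of_mem_fst k t s ω u w x S fun p hp =>
          ⟨(hT p (hS hp)).1, (hT p (hS hp)).2.1, (hT p (hS hp)).2.2.1,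
            (Finset.mem_sdiff.1 (hx p hp)).1⟩
        refine (Nat.mul_le_mul_right _ this).trans (le_of_eq ?_)
        have e : t + s - ω = (min k s - ω) + (min k t - 1) + ((t - k) + (s - k) + 1) := by omega
        rw [e, pow_add q _ ((t - k) + (s - k) + 1), pow_add q (min k s - ω)]
        ring
      · have hs1 : 1 ≤ s := hs ▸ Finset.card_pos.2 ⟨x, (Finset.mem_sdiff.1 (hx p₀ hp₀)).1⟩
        have := card_pairs_le_of_mem_fst k s t ω w u x (S.image Prod.swap) fun p' hp' => by
          obtain ⟨p, hp, rfl⟩ := Finset.mem_image.1 hp'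
          obtain ⟨⟨h1, h2, h3⟩, h4, h5, -⟩ := hT p (hS hp)
          exact ⟨⟨h2, h1, by rwa [Prod.fst_swap, Prod.snd_swap, Finset.inter_comm]⟩, h5, h4,
            (Finset.mem_sdiff.1 (hx p hp)).1⟩
        rw [Finset.card_image_of_injective _ Prod.swap_injective] at this
        refine (Nat.mul_le_mul_right _ this).trans ?_
        have e : t + s - ω = (min k t - ω) + (min k s - 1) + ((t - k) + (s - k) + 1) := by omega
        rw [e, pow_add q _ ((t - k) + (s - k) + 1), pow_add q (min k t - ω)]
        have h2 : 2 ^ s ≤ 2 ^ t := Nat.pow_le_pow_right two_pos hst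
        calc q ^ (min k t - ω) * 2 ^ s * q ^ (min k s - 1) * q ^ ((t - k) + (s - k) + 1)
            ≤ q ^ (min k t - ω) * 2 ^ t * q ^ (min k s - 1) * q ^ ((t - k) + (s - k) + 1) := by
              gcongr
          _ = _ := by ring
    · obtain ⟨h1, h2⟩ := hω.resolve_right hωk
      have := card_pairs_le_of_eval_crossDiff k t s ω hst u w x S
        (fun p hp => ⟨(hT p (hS hp)).1, (hT p (hS hp)).2.1, (hT p (hS hp)).2.2.1⟩)
        (fun p hp p' hp' => hside.elim
          (fun h => eval_crossDiff_of_mem_fst (h p hp) (h p' hp'))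
          (fun h => eval_crossDiff_of_mem_snd (h p hp) (h p' hp')))
      refine (Nat.mul_le_mul_right _ this).trans ?_
      have e : t + s - ω =
          (min k t - (t - ω)) + (t + k - 2 * ω - 1) + ((t - k) + (s - k) + 1) := by omega
      rw [e, pow_add q _ ((t - k) + (s - k) + 1), pow_add q (min k t - (t - ω))]
      exact Nat.le_mul_of_pos_left _ (by positivity)
  have h1 := key {p ∈ T | x ∈ p.1 \ p.2} (Finset.filter_subset _ _)
    (Or.inl fun p hp => (Finset.mem_filter.1 hp).2)
  have h2 := key {p ∈ T | ¬ x ∈ p.1 \ p.2} (Finset.filter_subset _ _) (Or.inr fun p hp => by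
    obtain ⟨hp, hx⟩ := Finset.mem_filter.1 hp
    have := (hT p hp).2.2.2
    simp only [Finset.mem_sdiff, Finset.mem_union, Finset.mem_inter] at this hx ⊢
    tauto)
  rw [← Finset.card_filter_add_card_filter_not (s := T) (fun p => x ∈ p.1 \ p.2), add_mul]
  linarith

/-- For fixed sizes there are at least a constant times `q ^ (t + s - ω)` feature pairs, unless
there are none. -/
lemma pow_le_card_featurePairs {F : Type*} [Fintype F] [DecidableEq F] {t s ω : ℕ}
    (hne : (featurePairs F t s ω).Nonempty) :
    Fintype.card F ^ (t + s - ω) ≤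
      (t + s - ω) ^ (t + s - ω) * (t + s - ω).factorial * (featurePairs F t s ω).card := by
  set q := Fintype.card F with hq
  set m := t + s - ω with hm
  have mem : ∀ p, p ∈ featurePairs F t s ω ↔
      p.1.card = t ∧ p.2.card = s ∧ (p.1 ∩ p.2).card = ω := fun p => by simp [featurePairs]
  obtain ⟨p₀, hp₀⟩ := hne
  obtain ⟨ht, hs, hω⟩ := (mem _).1 hp₀
  have hωt : ω ≤ t := hω ▸ ht ▸ Finset.card_le_card Finset.inter_subset_left
  have hωs : ω ≤ s := hω ▸ hs ▸ Finset.card_le_card Finset.inter_subset_right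
  have hmq : m ≤ q := by
    have := Finset.card_union_add_card_inter p₀.1 p₀.2
    have := Finset.card_le_univ (p₀.1 ∪ p₀.2)
    omega
  -- Every set of `m` elements is the union of some feature pair.
  have hchoose : q.choose m ≤ (featurePairs F t s ω).card := by
    rw [hq, ← Finset.card_univ, ← Finset.card_powersetCard]
    refine (Finset.card_le_card (t := (featurePairs F t s ω).image fun p => p.1 ∪ p.2) ?_).trans
      Finset.card_image_le
    intro U hU
    have hU := (Finset.mem_powersetCard.1 hU).2
    obtain ⟨A, hAU, hA⟩ := Finset.exists_subset_card_eq (s := U) (n := t) (by omega)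
    obtain ⟨D, hDA, hD⟩ := Finset.exists_subset_card_eq (s := A) (n := ω) (by omega)
    have hinter : A ∩ (D ∪ U \ A) = D := by
      ext y; have := @hDA y; simp; tauto
    have hdisj : Disjoint D (U \ A) := Finset.disjoint_of_subset_left hDA Finset.disjoint_sdiff
    refine Finset.mem_image.2 ⟨(A, D ∪ U \ A), (mem _).2 ⟨hA, ?_, ?_⟩, ?_⟩
    · simp only
      rw [Finset.card_union_of_disjoint hdisj, Finset.card_sdiff_of_subset hAU]
      omega
    · simp only [hinter, hD]
    · ext y; have h1 := @hDA y; have h2 := @hAU y; simp; tauto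
  have hpow : (q + 1 - m) ^ m ≤ m.factorial * q.choose m := by
    have := Nat.pow_le_choose (α := ℚ) m q
    rw [div_le_iff₀ (by positivity)] at this
    rw [mul_comm]
    exact_mod_cast this
  have hlin : q ^ m ≤ m ^ m * (q + 1 - m) ^ m := by
    rw [← mul_pow]
    rcases Nat.eq_zero_or_pos m with h0 | hpos
    · simp [h0]
    refine Nat.pow_le_pow_left ?_ m
    obtain ⟨d, hd⟩ := Nat.exists_eq_add_of_le hmq
    have hd' : q + 1 - m = d + 1 := by omega
    rw [hd', hd]
    -- `m + d ≤ m * (d + 1)` because `1 ≤ m`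
    nlinarith
  calc q ^ m ≤ m ^ m * (q + 1 - m) ^ m := hlin
    _ ≤ m ^ m * (m.factorial * q.choose m) := by gcongr
    _ ≤ m ^ m * (m.factorial * (featurePairs F t s ω).card) := by gcongr
    _ = _ := by ring

end Counting

/-! ### Reducing the attack to a counting problem -/

section Probability
open scoped ENNReal
variable {F : Type*} [Field F]

/-- The distribution of a vault record of a feature set with upper part `u`: in the probabilistic
variant uniform among the polynomials that agree with `u` in degrees `≥ k`, and `u` itself in the
deterministic variant. -/
noncomputable def recordDist [Fintype F] (v : Variant) (k : ℕ) (u : F[X]) : PMF F[X] :=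
  match v with
  | .probabilistic => (PMF.uniformOfFintype (Fin k → F)).map fun c => polyOfCoeffs c + u
  | .deterministic => PMF.pure u

lemma map_uniformOfFintype_equiv {α : Type*} [Fintype α] [Nonempty α] (e : α ≃ α) :
    (PMF.uniformOfFintype α).map e = PMF.uniformOfFintype α := by
  classical
  ext b
  rw [PMF.map_apply, tsum_eq_single (e.symm b)]
  · simp
  · intro a ha
    rw [if_neg]
    rintro rfl
    exact ha (e.symm_apply_apply a).symm

lemma vaultDist_eq_recordDist [Fintype F] (v : Variant) (k : ℕ) (A : Finset F) :
    vaultDist v k A = recordDist v k (upperPart k A) := by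
  cases v with
  | probabilistic =>
    -- Shifting the uniform coefficients absorbs the low-degree terms of `charPoly A`.
    have h := map_uniformOfFintype_equiv
      (Equiv.addRight fun i : Fin k => (charPoly A).coeff (i : ℕ))
    simp only [vaultDist, secretDist, recordDist]
    conv_rhs => rw [← h]
    have hfun : (fun f => f + charPoly A) ∘ polyOfCoeffs =
        (fun c => polyOfCoeffs c + upperPart k A) ∘
          (Equiv.addRight fun i : Fin k => (charPoly A).coeff (i : ℕ)) := by
      funext c
      simp only [Function.comp_apply, Equiv.coe_addRight, polyOfCoeffs_add, upperPart]
      abel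
    rw [PMF.map_comp, PMF.map_comp, hfun]
  | deterministic =>
    simp only [vaultDist, secretDist, recordDist, PMF.pure_map, upperPart, neg_add_eq_sub]

/-- The attack as a function of the upper parts of the two feature sets only. -/
noncomputable def attackOnUpperParts [Fintype F] (v w : Variant) (k : ℕ) (𝒜 : Attack F)
    (c : F[X] × F[X]) : PMF (Option F) :=
  (recordDist v k c.1).bind fun V => (recordDist w k c.2).bind fun W => 𝒜 V W

lemma experiment_eq [Fintype F] [DecidableEq F] (v w : Variant) (k : ℕ) {t s ω : ℕ}
    (hne : (featurePairs F t s ω).Nonempty) (𝒜 : Attack F) :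
    experiment v w k hne 𝒜 = (PMF.uniformOfFinset (featurePairs F t s ω) hne).bind fun p =>
      (attackOnUpperParts v w k 𝒜 (upperPart k p.1, upperPart k p.2)).map fun o => (p, o) := by
  simp only [experiment, attackOnUpperParts, PMF.map_bind, vaultDist_eq_recordDist]

/-- Guessing a hidden property of `p ∈ S` from its class `f p` alone: if at most `M` elements of
each class admit a given answer `x`, then any strategy `ρ` gives, summed over `S`, at most `M`
correct answers per class. -/
lemma sum_guess_le {ι κ α : Type*} [DecidableEq κ] [Fintype α] (S : Finset ι) (f : ι → κ)
    (Δ : ι → α → Prop) [∀ i x, Decidable (Δ i x)] (ρ : κ → PMF (Option α)) (M : ℕ)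
    (hM : ∀ c x, {i ∈ S | f i = c ∧ Δ i x}.card ≤ M) :
    ∑ i ∈ S, ∑ x, (if Δ i x then ρ (f i) (some x) else 0) ≤ ((S.image f).card * M : ℕ) := by
  have hclass : ∀ c, ∑ i ∈ S with f i = c, ∑ x, (if Δ i x then ρ (f i) (some x) else 0) ≤ M := by
    intro c
    have hρ : ∑ x, ρ c (some x) ≤ 1 := by
      rw [← (ρ c).tsum_coe, tsum_fintype, Fintype.sum_option]
      exact le_add_self
    calc ∑ i ∈ S with f i = c, ∑ x, (if Δ i x then ρ (f i) (some x) else 0)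
        = ∑ i ∈ S with f i = c, ∑ x, (if Δ i x then ρ c (some x) else 0) :=
          Finset.sum_congr rfl fun i hi => by rw [(Finset.mem_filter.1 hi).2]
      _ = ∑ x, ({i ∈ S | f i = c ∧ Δ i x}.card : ℝ≥0∞) * ρ c (some x) := by
          rw [Finset.sum_comm]
          refine Finset.sum_congr rfl fun x _ => ?_
          rw [← Finset.sum_filter, Finset.filter_filter, Finset.sum_const, nsmul_eq_mul]
      _ ≤ ∑ x, (M : ℝ≥0∞) * ρ c (some x) := by
          gcongr with x
          exact hM c x
      _ ≤ M := by
          rw [← Finset.mul_sum]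
          exact mul_le_of_le_one_right' hρ
  rw [← Finset.sum_fiberwise_of_maps_to (t := S.image f) fun i hi => Finset.mem_image_of_mem f hi]
  refine (Finset.sum_le_sum fun c _ => hclass c).trans ?_
  simp

lemma toOuterMeasure_experiment_eq [Fintype F] [DecidableEq F] (v w : Variant) (k : ℕ)
    {t s ω : ℕ} (hne : (featurePairs F t s ω).Nonempty) (𝒜 : Attack F) :
    (experiment v w k hne 𝒜).toOuterMeasure
        {z | ∃ x ∈ (z.1.1 ∪ z.1.2) \ (z.1.1 ∩ z.1.2), z.2 = some x} =
      ((featurePairs F t s ω).card : ℝ≥0∞)⁻¹ * ∑ p ∈ featurePairs F t s ω, ∑ x,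
        if x ∈ (p.1 ∪ p.2) \ (p.1 ∩ p.2) then
          attackOnUpperParts v w k 𝒜 (upperPart k p.1, upperPart k p.2) (some x) else 0 := by
  classical
  rw [experiment_eq, PMF.toOuterMeasure_bind_apply, tsum_fintype, Finset.mul_sum,
    ← Finset.sum_subset (Finset.subset_univ (featurePairs F t s ω))]
  · refine Finset.sum_congr rfl fun p hp => ?_
    rw [PMF.uniformOfFinset_apply_of_mem _ hp, PMF.toOuterMeasure_map_apply,
      PMF.toOuterMeasure_apply_fintype, Fintype.sum_option]
    congr 1
    simp [Set.indicator_apply]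
  · intro p _ hp
    rw [PMF.uniformOfFinset_apply_of_notMem _ hp, zero_mul]

lemma successProb_le [Fintype F] [DecidableEq F] (v w : Variant) (k : ℕ) {t s ω : ℕ}
    (hne : (featurePairs F t s ω).Nonempty) (𝒜 : Attack F) (M : ℕ)
    (hM : ∀ (u u' : F[X]) (x : F), ∀ T ⊆ featurePairs F t s ω,
      (∀ p ∈ T, upperPart k p.1 = u ∧ upperPart k p.2 = u' ∧
        x ∈ (p.1 ∪ p.2) \ (p.1 ∩ p.2)) → T.card ≤ M) :
    successProb v w k hne 𝒜 ≤
      (Fintype.card F ^ ((t - k) + (s - k)) * M : ℕ) / ((featurePairs F t s ω).card : ℝ) := by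
  classical
  let f : Finset F × Finset F → F[X] × F[X] := fun p => (upperPart k p.1, upperPart k p.2)
  have hcard : ((featurePairs F t s ω).image f).card ≤
      Fintype.card F ^ ((t - k) + (s - k)) := by
    have hmem : ∀ p ∈ featurePairs F t s ω, p.1.card = t ∧ p.2.card = s := fun p hp =>
      ⟨(Finset.mem_filter.1 hp).2.1, (Finset.mem_filter.1 hp).2.2.1⟩
    rw [pow_add]
    refine le_trans ?_ (Nat.mul_le_mul
      (card_image_upperPart_le k t ((featurePairs F t s ω).image Prod.fst) ?_)
      (card_image_upperPart_le k s ((featurePairs F t s ω).image Prod.snd) ?_))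
    · rw [← Finset.card_product]
      refine Finset.card_le_card fun c hc => ?_
      obtain ⟨p, hp, rfl⟩ := Finset.mem_image.1 hc
      exact Finset.mem_product.2 ⟨Finset.mem_image_of_mem _ (Finset.mem_image_of_mem _ hp),
        Finset.mem_image_of_mem _ (Finset.mem_image_of_mem _ hp)⟩
    · intro A hA
      obtain ⟨p, hp, rfl⟩ := Finset.mem_image.1 hA
      exact (hmem p hp).1
    · intro B hB
      obtain ⟨p, hp, rfl⟩ := Finset.mem_image.1 hB
      exact (hmem p hp).2
  have hsum := sum_guess_le (featurePairs F t s ω) f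
    (fun p x => x ∈ (p.1 ∪ p.2) \ (p.1 ∩ p.2)) (attackOnUpperParts v w k 𝒜) M (by
      rintro ⟨u, u'⟩ x
      refine hM u u' x _ (Finset.filter_subset _ _) fun p hp => ?_
      obtain ⟨-, h, hx⟩ := Finset.mem_filter.1 hp
      exact ⟨congrArg Prod.fst h, congrArg Prod.snd h, hx⟩)
  have hpos : (featurePairs F t s ω).card ≠ 0 := (Finset.card_pos.2 hne).ne'
  rw [successProb, toOuterMeasure_experiment_eq]
  refine (ENNReal.toReal_mono ?_ (mul_le_mul_right (hsum.trans
    (Nat.cast_le.2 (Nat.mul_le_mul_right M hcard))) _)).trans_eq ?_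
  · exact ENNReal.mul_ne_top (by simpa using hne.ne_empty) (ENNReal.natCast_ne_top _)
  · rw [ENNReal.toReal_mul, ENNReal.toReal_inv, ENNReal.toReal_natCast, ENNReal.toReal_natCast,
      mul_comm, div_eq_mul_inv]

end Probability
end FuzzyVault

theorem theorem5 (t s k ω : ℕ) (hk : 1 ≤ k) (hst : s ≤ t)
    (hω : (((t : ℝ) + k) / 2 > ω ∧ (ω : ℝ) ≥ (t : ℝ) - k) ∨ ω ≤ k) :
    ∃ C : ℝ, ∀ (F : Type*) [Field F] [Fintype F] [DecidableEq F]
      (hne : (FuzzyVault.featurePairs F t s ω).Nonempty)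
      (v w : FuzzyVault.Variant) (𝒜 : FuzzyVault.Attack F),
      FuzzyVault.successProb v w k hne 𝒜 ≤ C * (Fintype.card F : ℝ)⁻¹ := by
  have hω' : (2 * ω < t + k ∧ t ≤ ω + k) ∨ ω ≤ k := by
    refine hω.imp_left fun ⟨h1, h2⟩ => ⟨?_, ?_⟩
    · have : (2 * ω : ℝ) < t + k := by linarith
      exact_mod_cast this
    · have : (t : ℝ) ≤ ω + k := by linarith
      exact_mod_cast this
  let m := t + s - ω
  let K := 2 * 2 ^ t
  refine ⟨(K * (m ^ m * m.factorial) : ℕ), ?_⟩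
  intro F _ _ _ hne v w 𝒜
  set q := Fintype.card F with hq
  have hqpos : 0 < q := Fintype.card_pos
  let M := K * q ^ m / q ^ ((t - k) + (s - k) + 1)
  refine (FuzzyVault.successProb_le v w k hne 𝒜 M fun u u' x T hTsub hT => ?_).trans ?_
  · rw [Nat.le_div_iff_mul_le (by positivity)]
    exact FuzzyVault.card_pairs_mul_pow_le k t s ω hk hst hω' u u' x T fun p hp =>
      ⟨(Finset.mem_filter.1 (hTsub hp)).2, hT p hp⟩
  · have hN : 0 < (FuzzyVault.featurePairs F t s ω).card := Finset.card_pos.2 hne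
    rw [← div_eq_mul_inv, div_le_div_iff₀ (by exact_mod_cast hN) (by exact_mod_cast hqpos)]
    norm_cast
    calc q ^ ((t - k) + (s - k)) * M * q = M * q ^ ((t - k) + (s - k) + 1) := by ring
      _ ≤ K * q ^ m := Nat.div_mul_le_self _ _
      _ ≤ K * (m ^ m * m.factorial * (FuzzyVault.featurePairs F t s ω).card) :=
          Nat.mul_le_mul_left _ (FuzzyVault.pow_le_card_featurePairs hne)
      _ = _ := by ring
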